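/- All graphs are finite and simple. The independence polynomial of $G$ is $I(G,x)=\sum_j i_j x^j$, where $i_j$ is the number of independent sets of vertices of $G$ of cardinality $j$. A graph $H$ with $n$ vertices and $m$ edges is called optimally-least (for order $n$ and size $m$) if $I(H,x)\le I(G,x)$ for every graph $G$ with $n$ vertices and $m$ edges and every real $x\ge 0$. (1) Let $n\ge 2$, $1\le k\le\lfloor n/2\rfloor$, and suppose $m=\binom n2-\lceil n/2\rceil\lfloor n/2\rfloor-k\ge 0$. Let $H$ be any graph formed from the disjoint union $K_{\lceil n/2\rceil}\cup K_{\lfloor n/2\rfloor}$ by deleting $k$ edges of the clique $K_{\lceil n/2\rceil}$ in such a way that no independent set of size $3$ is formed in that part. Then $H$ has order $n$ and size $m$, and $$I(H,x)=1+nx+\left(\binom n2-m\right)x^2+k\lfloor n/2\rfloor x^3 .$$ If moreover $k<n/2$, then such a set of $k$ edges exists, and every such graph $H$ is optimally-least for order $n$ and size $m$. (2) Let $a\ge b\ge 1$, $n=2a+b$ and $m=a(a-1)+\frac{b(b-1)}2$. Then the disjoint union $2K_a\cup K_b$ is optimally-least for order $n$ and size $m$, and $$I(2K_a\cup K_b,x)=1+nx+\left(\binom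 n2-m\right)x^2+a^2b\,x^3 .$$ -/

import Mathlib

open Polynomial SimpleGraph

/-- The number of independent sets of cardinality `j` of the graph `G`. -/
noncomputable def indepCount {V : Type} (G : SimpleGraph V) (j : ℕ) : ℕ :=
  {s : Finset V | G.IsNIndepSet j s}.ncard

/-- The independence polynomial `∑ j, i_j x ^ j` of a finite graph; `i_j` is the number of
independent sets of cardinality `j`, which is zero for `j` larger than the order. -/
noncomputable def indepPoly {V : Type} [Fintype V] (G : SimpleGraph V) : ℝ[X] :=
  ∑ j ∈ Finset.range (Fintype.card V + 1), C (indepCount G j : ℝ) * X ^ j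

/-- `G` is a simple graph of order `n` (number of vertices) and size `m` (number of edges). -/
def HasOrderSize {V : Type} [Fintype V] (n m : ℕ) (G : SimpleGraph V) : Prop :=
  Fintype.card V = n ∧ G.edgeSet.ncard = m

/-- `H` has order `n` and size `m`, and `I(H, x) ≤ I(G, x)` for every graph `G` of order `n` and
size `m` and every real `x ≥ 0`. -/
def IsOptimallyLeast {V : Type} [Fintype V] (n m : ℕ) (H : SimpleGraph V) : Prop :=
  HasOrderSize n m H ∧
    ∀ (W : Type) [Fintype W] (G : SimpleGraph W), HasOrderSize n m G →
      ∀ x : ℝ, 0 ≤ x → (indepPoly H).eval x ≤ (indepPoly G).eval x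

/-- `D` consists of exactly `k` edges of the complete graph on `p` vertices, and deleting them
creates no independent set of size `3`. -/
def IsGoodDeletion (p k : ℕ) (D : Finset (Sym2 (Fin p))) : Prop :=
  (D : Set (Sym2 (Fin p))) ⊆ (completeGraph (Fin p)).edgeSet ∧ D.card = k ∧
    ((completeGraph (Fin p)).deleteEdges (D : Set (Sym2 (Fin p)))).IndepSetFree 3

/-- The disjoint union of `K_p` with the edges in `D` deleted, and `K_q`. -/
def deletedTwoCliques (p q : ℕ) (D : Finset (Sym2 (Fin p))) : SimpleGraph (Fin p ⊕ Fin q) :=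
  (completeGraph (Fin p)).deleteEdges (D : Set (Sym2 (Fin p))) ⊕g completeGraph (Fin q)

/-- The disjoint union `2K_a ∪ K_b`. -/
def threeCliques (a b : ℕ) : SimpleGraph ((Fin a ⊕ Fin a) ⊕ Fin b) :=
  (completeGraph (Fin a) ⊕g completeGraph (Fin a)) ⊕g completeGraph (Fin b)

/-! ### Counting edges and triangles inside vertex sets. -/

section CliqueCount

open Finset
open scoped Classical

variable {V : Type*}

/-! Pass to complements: the independent sets of sizes 2 and 3 of G are the edges and triangles of
F, the complement of G. Independence polynomials multiply over disjoint unions, so that of H is a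
cubic; its coefficients up to degree 2 depend only on n and m. Coefficients are nonnegative, so for
x ≥ 0 it suffices that every F with the order and size of the complement of H has at least as many
triangles (`isOptimallyLeast_of_cliqueCount`).

For 2K_a ∪ K_b this follows from Fisher's inequality (`exists_cubic_le_cliqueCount_three`). Let 1/y
be the first point where the dependence polynomial of some induced subgraph vanishes. A Bonferroni
inequality there gives t ≥ y³ - ny² + ey for the number t of triangles. With the parameters of
K_{a,a,b}, the right side minus a²b is (y - a)²(y - b), and y ≥ b.

For two cliques it is the Lovász–Simonovits bound k⌊n/2⌋ (`cliqueCount_three_ge`), by descending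
induction on k. The induction starts from K_{h,h,1} in odd order, and in even order from a bound
between two tripartite sizes (`cliqueCount_three_ge_even_high`). Where structure is needed,
nonadjacent pairs have large codegree, so the neighbourhood of a vertex of minimum degree is joined
almost completely to the rest; `cliqueCount_three_ge_of_nbr` then counts triangles. -/

/-- The cliques of the graph `F` contained in `S`. -/
noncomputable def cliquesIn (F : SimpleGraph V) (S : Finset V) : Finset (Finset V) :=
  S.powerset.filter fun T => F.IsClique (T : Set V)

/-- The number of cliques of cardinality `j` of the graph `F` contained in `S`. -/
noncomputable def cliqueCount (F : SimpleGraph V) (S : Finset V) (j : ℕ) : ℕ :=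
  #{T ∈ cliquesIn F S | #T = j}

theorem mem_cliquesIn {F : SimpleGraph V} {S T : Finset V} :
    T ∈ cliquesIn F S ↔ T ⊆ S ∧ F.IsClique (T : Set V) := by
  rw [cliquesIn, mem_filter, mem_powerset]

/-- The elements of `S` adjacent to `v`. -/
noncomputable def nbrIn (F : SimpleGraph V) (S : Finset V) (v : V) : Finset V :=
  {u ∈ S | F.Adj v u}

theorem mem_nbrIn {F : SimpleGraph V} {S : Finset V} {u v : V} :
    u ∈ nbrIn F S v ↔ u ∈ S ∧ F.Adj v u := by
  simp [nbrIn]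

theorem nbrIn_subset (F : SimpleGraph V) (S : Finset V) (v : V) : nbrIn F S v ⊆ S :=
  filter_subset _ _

theorem nbrIn_mono (F : SimpleGraph V) {S T : Finset V} (h : S ⊆ T) (v : V) :
    nbrIn F S v ⊆ nbrIn F T v :=
  filter_subset_filter _ h

/-- Sums over the cliques in `insert v S`, split according to whether `v` belongs to the clique. -/
theorem sum_cliques_insert {R : Type*} [AddCommMonoid R] (F : SimpleGraph V) {S : Finset V} {v : V}
    (hv : v ∉ S) (f : ℕ → R) :
    ∑ T ∈ cliquesIn F (insert v S), f (#T) =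
      ∑ T ∈ cliquesIn F S, f (#T) + ∑ T ∈ cliquesIn F (nbrIn F S v), f (#T + 1) := by
  unfold cliquesIn
  rw [sum_filter, sum_powerset_insert hv, ← sum_filter]
  congr 1
  have hsub : (nbrIn F S v).powerset ⊆ S.powerset := powerset_mono.2 (nbrIn_subset F S v)
  rw [sum_filter, ← sum_subset hsub]
  · refine sum_congr rfl fun T hT => ?_
    have hT' := mem_powerset.1 hT
    have hvT : v ∉ T := fun h => hv (nbrIn_subset F S v (hT' h))
    have : F.IsClique ((insert v T : Finset V) : Set V) ↔ F.IsClique (T : Set V) := by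
      rw [coe_insert, isClique_insert]
      exact ⟨fun h => h.1, fun h => ⟨h, fun b hb _ => (mem_nbrIn.1 (hT' hb)).2⟩⟩
    simp only [this, card_insert_of_notMem hvT]
  · intro T hT hT'
    refine if_neg fun hc => hT' (mem_powerset.2 fun u hu => mem_nbrIn.2 ⟨mem_powerset.1 hT hu, ?_⟩)
    rw [coe_insert, isClique_insert] at hc
    exact hc.2 u hu fun h => hv (h ▸ mem_powerset.1 hT hu)

theorem cliqueCount_eq_sum (F : SimpleGraph V) (S : Finset V) (j : ℕ) :
    cliqueCount F S j =
      ∑ T ∈ cliquesIn F S, if #T = j then 1 else 0 := by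
  rw [cliqueCount, card_filter]

theorem cliqueCount_insert (F : SimpleGraph V) {S : Finset V} {v : V} (hv : v ∉ S) (j : ℕ) :
    cliqueCount F (insert v S) (j + 1) =
      cliqueCount F S (j + 1) + cliqueCount F (nbrIn F S v) j := by
  simp only [cliqueCount_eq_sum]
  rw [sum_cliques_insert F hv fun i => if i = j + 1 then 1 else 0]
  simp

theorem cliqueCount_zero (F : SimpleGraph V) (S : Finset V) : cliqueCount F S 0 = 1 := by
  rw [cliqueCount, card_eq_one]
  refine ⟨∅, ?_⟩
  ext T
  simp only [mem_filter, mem_cliquesIn, card_eq_zero, mem_singleton]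
  constructor
  · exact fun h => h.2
  · rintro rfl; simp

theorem cliqueCount_empty_succ (F : SimpleGraph V) (j : ℕ) : cliqueCount F ∅ (j + 1) = 0 := by
  rw [cliqueCount, card_eq_zero, filter_eq_empty_iff]
  intro T hT h
  rw [mem_cliquesIn, subset_empty] at hT
  simp [hT.1] at h

theorem cliqueCount_one (F : SimpleGraph V) (S : Finset V) : cliqueCount F S 1 = #S := by
  induction S using Finset.induction_on with
  | empty => simp [cliqueCount_empty_succ]
  | insert v S hv ih => rw [cliqueCount_insert F hv, cliqueCount_zero, ih, card_insert_of_notMem hv]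

theorem cliqueCount_two_insert (F : SimpleGraph V) {S : Finset V} {v : V} (hv : v ∉ S) :
    cliqueCount F (insert v S) 2 = cliqueCount F S 2 + #(nbrIn F S v) := by
  rw [cliqueCount_insert F hv, cliqueCount_one]

theorem cliqueCount_congr {F F' : SimpleGraph V} {S : Finset V}
    (h : ∀ x ∈ S, ∀ y ∈ S, F.Adj x y ↔ F'.Adj x y) (j : ℕ) :
    cliqueCount F S j = cliqueCount F' S j := by
  rw [cliqueCount, cliqueCount, cliquesIn, cliquesIn]
  congr 2
  refine filter_congr fun T hT => ?_
  have hT' := mem_powerset.1 hT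
  have : F.IsClique (T : Set V) ↔ F'.IsClique (T : Set V) :=
    ⟨fun hc x hx y hy hxy => (h x (hT' hx) y (hT' hy)).1 (hc hx hy hxy),
      fun hc x hx y hy hxy => (h x (hT' hx) y (hT' hy)).2 (hc hx hy hxy)⟩
  rw [this]

theorem cliqueCount_two_union_ge (F : SimpleGraph V) (A B : Finset V) (h : Disjoint A B) :
    cliqueCount F A 2 + ∑ b ∈ B, #(nbrIn F A b) ≤ cliqueCount F (A ∪ B) 2 := by
  induction B using Finset.induction_on with
  | empty => simp
  | insert b B hb ih =>
    rw [disjoint_insert_right] at h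
    have hb' : b ∉ A ∪ B := by simp [h.1, hb]
    rw [sum_insert hb, union_insert, cliqueCount_two_insert F hb']
    have := card_le_card (nbrIn_mono F (subset_union_left (s₁ := A) (s₂ := B)) b)
    have := ih h.2
    omega

theorem cliqueCount_two_union_le (F : SimpleGraph V) (A B : Finset V) (h : Disjoint A B) :
    cliqueCount F (A ∪ B) 2 ≤ cliqueCount F A 2 + ∑ b ∈ B, #(nbrIn F (A ∪ B) b) := by
  induction B using Finset.induction_on with
  | empty => simp
  | insert b B hb ih =>
    rw [disjoint_insert_right] at h
    have hb' : b ∉ A ∪ B := by simp [h.1, hb]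
    rw [sum_insert hb, union_insert, cliqueCount_two_insert F hb']
    have h1 := card_le_card (nbrIn_mono F (subset_insert b (A ∪ B)) b)
    have h2 : ∑ x ∈ B, #(nbrIn F (A ∪ B) x) ≤ ∑ x ∈ B, #(nbrIn F (insert b (A ∪ B)) x) :=
      sum_le_sum fun x _ => card_le_card (nbrIn_mono F (subset_insert b (A ∪ B)) x)
    have := ih h.2
    omega

theorem sum_card_nbrIn (F : SimpleGraph V) (S : Finset V) :
    ∑ v ∈ S, #(nbrIn F S v) = 2 * cliqueCount F S 2 := by
  induction S using Finset.induction_on with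
  | empty => simp [cliqueCount_empty_succ]
  | insert v S hv ih =>
    rw [sum_insert hv, cliqueCount_two_insert F hv, mul_add, ← ih]
    have h1 : nbrIn F (insert v S) v = nbrIn F S v := by
      ext u; simp only [mem_nbrIn, mem_insert]
      exact ⟨fun h => ⟨h.1.resolve_left fun e => F.loopless.irrefl v (e ▸ h.2), h.2⟩,
        fun h => ⟨Or.inr h.1, h.2⟩⟩
    have h2 : ∀ x ∈ S, #(nbrIn F (insert v S) x) = #(nbrIn F S x) + if F.Adj v x then 1 else 0 := by
      intro x _
      rw [nbrIn, filter_insert]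
      by_cases hx : F.Adj x v
      · rw [if_pos hx, if_pos hx.symm, card_insert_of_notMem (by simp [hv])]; rfl
      · rw [if_neg hx, if_neg fun h => hx h.symm]; rfl
    rw [h1, sum_congr rfl h2, sum_add_distrib, ← card_filter]
    change _ + (_ + #(nbrIn F S v)) = _
    ring

/-- The effect of adding one edge on the numbers of edges and triangles. -/
theorem cliqueCount_add_edge [Fintype V] {F F' : SimpleGraph V} {u w : V} (huw : u ≠ w)
    (hn : ¬ F.Adj u w)
    (h : ∀ x y, F'.Adj x y ↔ F.Adj x y ∨ (x = u ∧ y = w) ∨ (x = w ∧ y = u)) :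
    cliqueCount F' univ 2 = cliqueCount F univ 2 + 1 ∧
      cliqueCount F' univ 3 =
        cliqueCount F univ 3 + #(nbrIn F (nbrIn F univ u) w) := by
  have huniv : (univ : Finset V) = insert u (univ.erase u) := (insert_erase (mem_univ u)).symm
  have hu : u ∉ univ.erase u := notMem_erase u univ
  have hN : nbrIn F' (univ.erase u) u = insert w (nbrIn F (univ.erase u) u) := by
    ext x
    simp only [mem_nbrIn, mem_insert, mem_erase, mem_univ, and_true, h]
    constructor
    · rintro ⟨h1, h2 | h2 | h2⟩
      · exact Or.inr ⟨h1, h2⟩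
      · exact Or.inl h2.2
      · exact absurd h2.1 huw
    · rintro (rfl | h1)
      · exact ⟨huw.symm, by simp⟩
      · exact ⟨h1.1, Or.inl h1.2⟩
  have hw : w ∉ nbrIn F (univ.erase u) u := fun hw => hn (mem_nbrIn.1 hw).2
  have hc : ∀ S : Finset V, u ∉ S → ∀ j, cliqueCount F' S j = cliqueCount F S j := by
    refine fun S hS j => cliqueCount_congr (fun x hx y hy => ?_) j
    rw [h]
    refine ⟨fun h' => h'.resolve_right ?_, Or.inl⟩
    rintro (h' | h')
    · exact hS (h'.1 ▸ hx)
    · exact hS (h'.2 ▸ hy)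
  have hE : nbrIn F (univ.erase u) u = nbrIn F univ u := by
    ext x
    simp only [mem_nbrIn, mem_erase, mem_univ, and_true, true_and, and_iff_right_iff_imp]
    exact fun h => h.ne'
  have hS : nbrIn F' (nbrIn F (univ.erase u) u) w = nbrIn F (nbrIn F univ u) w := by
    rw [hE]
    ext x
    simp only [mem_nbrIn, mem_univ, true_and, h]
    refine ⟨fun h' => ⟨h'.1, h'.2.resolve_right ?_⟩, fun h' => ⟨h'.1, Or.inl h'.2⟩⟩
    rintro (h'' | h'')
    · exact huw h''.1.symm
    · exact F.loopless.irrefl u (h'' ▸ h'.1)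
  have hu' : u ∉ nbrIn F (univ.erase u) u := fun h => hu (nbrIn_subset _ _ _ h)
  constructor
  · rw [huniv, cliqueCount_two_insert F' hu, cliqueCount_two_insert F hu, hc _ hu, hN,
      card_insert_of_notMem hw, add_assoc]
  · rw [huniv, cliqueCount_insert F' hu, cliqueCount_insert F hu, hc _ hu, hN,
      cliqueCount_two_insert F' hw, hc _ hu', hS, ← huniv, add_assoc]

/-- Triangles of a graph split into the neighbourhood of a set `N` and its complement. -/
theorem cliqueCount_three_union_ge (F : SimpleGraph V) (N M : Finset V) (hd : Disjoint N M)
    (c μ : ℕ) (hμ : ∀ w ∈ M, #N ≤ #(nbrIn F N w) + μ) (hN : c + 2 * μ ≤ #N)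
    (hc : ∀ w ∈ M, ∀ u ∈ N, ¬ F.Adj w u → #(nbrIn F N u) ≤ c) :
    #M * cliqueCount F N 2 + c * cliqueCount F (N ∪ M) 2 ≤
      cliqueCount F (N ∪ M) 3 + c * cliqueCount F N 2 + c * (#N * #M) := by
  induction M using Finset.induction_on with
  | empty => simp
  | insert w M hw ih =>
    rw [disjoint_insert_right] at hd
    have hw' : w ∉ N ∪ M := by simp [hd.1, hw]
    have ih' := ih hd.2 (fun x hx => hμ x (mem_insert_of_mem hx))
      (fun x hx => hc x (mem_insert_of_mem hx))
    rw [union_insert, cliqueCount_two_insert F hw', cliqueCount_insert F hw',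
      card_insert_of_notMem hw]
    have hNM : nbrIn F (N ∪ M) w = nbrIn F N w ∪ nbrIn F M w := filter_union _ _ _
    have hd' : Disjoint (nbrIn F N w) (nbrIn F M w) :=
      disjoint_of_subset_left (nbrIn_subset F N w)
        (disjoint_of_subset_right (nbrIn_subset F M w) hd.2)
    rw [hNM, card_union_of_disjoint hd']
    -- New triangles are edges inside the neighbourhood of `w`; those with both ends in `M` are
    -- discarded. By inclusion–exclusion, `w` and a neighbour in `M` share at least #N - 2μ ≥ c
    -- vertices of `N`.
    have h1 := cliqueCount_two_union_ge F _ _ hd'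
    have h2 : #(nbrIn F M w) * c ≤ ∑ b ∈ nbrIn F M w, #(nbrIn F (nbrIn F N w) b) := by
      rw [← smul_eq_mul]
      refine card_nsmul_le_sum _ _ _ fun b hb => ?_
      have h3 := hμ w (mem_insert_self w M)
      have h4 := hμ b (mem_insert_of_mem (nbrIn_subset F M w hb))
      have h5 : #(nbrIn F N b) ≤ #(nbrIn F (nbrIn F N w) b) + (#N - #(nbrIn F N w)) := by
        rw [← card_sdiff_of_subset (nbrIn_subset F N w)]
        refine le_trans (card_le_card ?_) (card_union_le _ _)
        intro x hx
        rw [mem_nbrIn] at hx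
        simp only [mem_union, mem_nbrIn, mem_sdiff]
        by_cases hxw : F.Adj w x
        · exact Or.inl ⟨⟨hx.1, hxw⟩, hx.2⟩
        · exact Or.inr ⟨hx.1, fun h => hxw h.2⟩
      omega
    -- Each vertex of `N` missed by `w` loses at most `c` edges of `N`; the term `c * (#N * #M)`
    -- pays for this.
    have h6 : cliqueCount F N 2 ≤ cliqueCount F (nbrIn F N w) 2 + (#N - #(nbrIn F N w)) * c := by
      have h7 := cliqueCount_two_union_le F (nbrIn F N w) (N \ nbrIn F N w) disjoint_sdiff
      rw [union_sdiff_of_subset (nbrIn_subset F N w)] at h7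
      refine h7.trans (Nat.add_le_add_left ?_ _)
      rw [← card_sdiff_of_subset (nbrIn_subset F N w), ← smul_eq_mul]
      refine sum_le_card_nsmul _ _ _ fun b hb => ?_
      rw [mem_sdiff] at hb
      exact hc w (mem_insert_self w M) b hb.1 fun h => hb.2 (mem_nbrIn.2 ⟨hb.1, h⟩)
    have h8 := card_le_card (nbrIn_subset F N w)
    obtain ⟨d, hd''⟩ := Nat.exists_eq_add_of_le h8
    rw [hd''] at ih' h6 ⊢
    rw [Nat.add_sub_cancel_left] at h6
    nlinarith

/-- A lower bound for the number of triangles of a graph in which every vertex outside the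
neighbourhood `N` of `v` is adjacent to almost all of `N`. -/
theorem cliqueCount_three_ge_of_nbr [Fintype V] (F : SimpleGraph V) (v : V) (c μ : ℕ)
    (hμ : ∀ w, w ≠ v → ¬ F.Adj v w →
      #(nbrIn F univ v) ≤ #(nbrIn F (nbrIn F univ v) w) + μ)
    (hN : c + 2 * μ ≤ #(nbrIn F univ v)) (hM : c + #(nbrIn F univ v) ≤ Fintype.card V)
    (hc : ∀ u w, F.Adj v u → ¬ F.Adj v w → ¬ F.Adj w u → #(nbrIn F (nbrIn F univ v) u) ≤ c) :
    c * cliqueCount F univ 2 ≤ cliqueCount F univ 3 +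
      c * (#(nbrIn F univ v) * (Fintype.card V - #(nbrIn F univ v))) := by
  have h := cliqueCount_three_union_ge F (nbrIn F univ v) (univ \ nbrIn F univ v) disjoint_sdiff
    c μ ?_ hN ?_
  · rw [union_sdiff_of_subset (subset_univ _), card_sdiff_of_subset (subset_univ _), card_univ] at h
    -- The complement of the neighbourhood has at least `c` vertices, so the edges inside the
    -- neighbourhood cancel in the right direction.
    have h1 : c * cliqueCount F (nbrIn F univ v) 2 ≤
        (Fintype.card V - #(nbrIn F univ v)) * cliqueCount F (nbrIn F univ v) 2 :=
      Nat.mul_le_mul_right _ (by omega)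
    omega
  · intro w hw
    rw [mem_sdiff, mem_nbrIn] at hw
    by_cases hwv : w = v
    · subst hwv
      refine le_trans (card_le_card fun x hx => ?_) (Nat.le_add_right _ _)
      exact mem_nbrIn.2 ⟨hx, (mem_nbrIn.1 hx).2⟩
    · exact hμ w hwv fun h => hw.2 ⟨mem_univ _, h⟩
  · intro w hw u hu hwu
    rw [mem_sdiff, mem_nbrIn] at hw
    exact hc u w (mem_nbrIn.1 hu).2 (fun h => hw.2 ⟨mem_univ _, h⟩) hwu

end CliqueCount

/-! ### Fisher's inequality through dependence polynomials. -/

section Fisher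

open Finset
open scoped Classical

variable {V : Type*}

/-- The dependence polynomial `∑ (-z) ^ |T|` over the cliques `T` contained in `S`. -/
noncomputable def dependencePoly (F : SimpleGraph V) (S : Finset V) (z : ℝ) : ℝ :=
  ∑ T ∈ cliquesIn F S, (-z) ^ #T

theorem dependencePoly_insert (F : SimpleGraph V) {S : Finset V} {v : V} (hv : v ∉ S) (z : ℝ) :
    dependencePoly F (insert v S) z =
      dependencePoly F S z - z * dependencePoly F (nbrIn F S v) z := by
  rw [dependencePoly, sum_cliques_insert F hv fun i => (-z) ^ i, dependencePoly, dependencePoly,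
    sub_eq_add_neg, ← neg_mul, mul_sum]
  simp only [pow_succ']

theorem dependencePoly_empty (F : SimpleGraph V) (z : ℝ) : dependencePoly F ∅ z = 1 := by
  have : cliquesIn F ∅ = {∅} := by
    ext T
    rw [mem_cliquesIn, subset_empty, mem_singleton]
    exact ⟨fun h => h.1, by rintro rfl; simp⟩
  rw [dependencePoly, this, sum_singleton, card_empty, pow_zero]

theorem dependencePoly_at_zero (F : SimpleGraph V) (S : Finset V) :
    dependencePoly F S 0 = 1 := by
  induction S using Finset.induction_on with
  | empty => exact dependencePoly_empty F 0
  | insert v S hv ih => rw [dependencePoly_insert F hv, ih, zero_mul, sub_zero]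

theorem continuous_dependencePoly (F : SimpleGraph V) (S : Finset V) :
    Continuous (dependencePoly F S) := by
  unfold dependencePoly
  fun_prop

theorem dependencePoly_anti (F : SimpleGraph V) {z : ℝ} (hz : 0 ≤ z)
    (h : ∀ S, 0 ≤ dependencePoly F S z) {S T : Finset V} (hST : S ⊆ T) :
    dependencePoly F T z ≤ dependencePoly F S z := by
  rw [← union_sdiff_of_subset hST]
  have hd : Disjoint S (T \ S) := disjoint_sdiff
  generalize T \ S = B at hd
  induction B using Finset.induction_on with
  | empty => rw [union_empty]
  | insert v B hv ih =>
    rw [disjoint_insert_right] at hd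
    have hv' : v ∉ S ∪ B := by simp [hd.1, hv]
    rw [union_insert, dependencePoly_insert F hv']
    linarith [mul_nonneg hz (h (nbrIn F (S ∪ B) v)), ih hd.2]

/-- Bonferroni inequalities for the dependence polynomial. -/
theorem dependencePoly_bonferroni (F : SimpleGraph V) {z : ℝ} (hz : 0 ≤ z)
    (h : ∀ S, 0 ≤ dependencePoly F S z) (m : ℕ) (S : Finset V) :
    0 ≤ (-1) ^ m * (dependencePoly F S z - ∑ j ∈ range m, (-z) ^ j * cliqueCount F S j) := by
  induction m generalizing S with
  | zero => simpa using h S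
  | succ m ihm =>
    induction S using Finset.induction_on with
    | empty =>
      rw [sum_range_succ', cliqueCount_zero, dependencePoly_empty]
      simp [cliqueCount_empty_succ]
    | insert v S hv ih =>
      have h1 := mul_nonneg hz (ihm (nbrIn F S v))
      -- Truncations obey the same recursion as the polynomial, with the order dropping by one on
      -- the neighbourhood.
      have h2 : ∑ j ∈ range (m + 1), (-z) ^ j * (cliqueCount F (insert v S) j : ℝ) =
          ∑ j ∈ range (m + 1), (-z) ^ j * (cliqueCount F S j : ℝ) -
            z * ∑ j ∈ range m, (-z) ^ j * (cliqueCount F (nbrIn F S v) j : ℝ) := by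
        rw [sum_range_succ', sum_range_succ' (fun j => (-z) ^ j * (cliqueCount F S j : ℝ)),
          cliqueCount_zero, cliqueCount_zero, mul_sum, add_sub_right_comm, ← sum_sub_distrib]
        congr 1
        refine sum_congr rfl fun j _ => ?_
        rw [cliqueCount_insert F hv]
        push_cast
        ring
      rw [dependencePoly_insert F hv, h2]
      refine (add_nonneg ih h1).trans_eq ?_
      rw [pow_succ]
      ring

/-- Adding `u` subtracts `z` times the value on the part of its neighbourhood already present, which
by antitonicity is at least the value on the full neighbourhood. -/
theorem dependencePoly_union_le (F : SimpleGraph V) {z : ℝ} (hz : 0 ≤ z)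
    (h : ∀ S, 0 ≤ dependencePoly F S z) (S M : Finset V) (hd : Disjoint S M) [Fintype V] :
    dependencePoly F (S ∪ M) z ≤
      dependencePoly F S z - z * ∑ u ∈ M, dependencePoly F (nbrIn F univ u) z := by
  induction M using Finset.induction_on with
  | empty => simp
  | insert u M hu ih =>
    rw [disjoint_insert_right] at hd
    have hu' : u ∉ S ∪ M := by simp [hd.1, hu]
    rw [union_insert, dependencePoly_insert F hu', sum_insert hu]
    have := mul_le_mul_of_nonneg_left
      (dependencePoly_anti F hz h (nbrIn_mono F (subset_univ (S ∪ M)) u)) hz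
    linarith [ih hd.2]

/-- A symmetric nonnegative matrix with a positive vector `p` such that `z A p ≤ p` has
average row sum at most `1 / z`. -/
theorem sum_sum_le_of_mulVec_le {ι : Type*} [Fintype ι] (A : ι → ι → ℝ) (p : ι → ℝ) {z : ℝ}
    (hz : 0 ≤ z) (hA : ∀ i j, 0 ≤ A i j) (hs : ∀ i j, A i j = A j i) (hp : ∀ i, 0 < p i)
    (h : ∀ i, z * ∑ j, A i j * p j ≤ p i) :
    z * ∑ i, ∑ j, A i j ≤ Fintype.card ι := by
  have h1 : ∑ i, ∑ j, A i j * (p j / p i) = ∑ i, ∑ j, A i j * (p i / p j) := by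
    rw [sum_comm]
    exact sum_congr rfl fun i _ => sum_congr rfl fun j _ => by rw [hs]
  -- After symmetrising, this is p_j/p_i + p_i/p_j ≥ 2.
  have h2 : 2 * ∑ i, ∑ j, A i j ≤ 2 * ∑ i, ∑ j, A i j * (p j / p i) := by
    rw [two_mul (∑ i, ∑ j, A i j * (p j / p i))]
    nth_rewrite 2 [h1]
    rw [← sum_add_distrib, mul_sum]
    refine sum_le_sum fun i _ => ?_
    rw [← sum_add_distrib, mul_sum]
    refine sum_le_sum fun j _ => ?_
    rw [← mul_add, mul_comm]
    refine mul_le_mul_of_nonneg_left ?_ (hA i j)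
    have hi := hp i
    have hj := hp j
    rw [div_add_div _ _ hi.ne' hj.ne', le_div_iff₀ (mul_pos hi hj)]
    nlinarith [sq_nonneg (p i - p j)]
  have h3 : z * ∑ i, ∑ j, A i j * (p j / p i) ≤ ∑ _i : ι, (1 : ℝ) := by
    rw [mul_sum]
    refine sum_le_sum fun i _ => ?_
    have : z * ∑ j, A i j * (p j / p i) = (z * ∑ j, A i j * p j) / p i := by
      rw [mul_div_assoc, sum_div]
      simp only [mul_div_assoc]
    rw [this, div_le_one (hp i)]
    exact h i
  have h4 := mul_le_mul_of_nonneg_left (le_of_mul_le_mul_left h2 two_pos) hz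
  simpa using h4.trans h3

/-- Take for `A` the nonadjacency matrix with ones on the diagonal, whose entries sum to n² - 2e,
and for `p` the values on neighbourhoods. Positivity on the whole vertex set gives zAp ≤ p. -/
theorem mul_le_card_of_dependencePoly_pos [Fintype V] (F : SimpleGraph V) {z : ℝ} (hz : 0 ≤ z)
    (h : ∀ S, 0 < dependencePoly F S z) :
    z * ((Fintype.card V : ℝ) ^ 2 - 2 * cliqueCount F univ 2) ≤ Fintype.card V := by
  have h0 : ∀ S, 0 ≤ dependencePoly F S z := fun S => (h S).le
  have key := sum_sum_le_of_mulVec_le (fun u v => if F.Adj u v then (0 : ℝ) else 1)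
    (fun v => dependencePoly F (nbrIn F univ v) z) hz (fun u v => by split_ifs <;> simp)
    (fun u v => by simp only [F.adj_comm]) (fun v => h _) ?_
  · refine le_trans (le_of_eq ?_) key
    congr 1
    have h1 : ∀ u v, (if F.Adj u v then (0 : ℝ) else 1) = 1 - if F.Adj u v then 1 else 0 := by
      intro u v; split_ifs <;> simp
    simp only [h1, sum_sub_distrib]
    have h2 := sum_card_nbrIn F univ
    have h3 : ∑ u, ∑ v, (if F.Adj u v then (1 : ℝ) else 0) = 2 * cliqueCount F univ 2 := by
      rw [← Nat.cast_ofNat (n := 2), ← Nat.cast_mul, ← h2, Nat.cast_sum]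
      refine sum_congr rfl fun u _ => ?_
      rw [nbrIn, card_filter]
      push_cast
      rfl
    rw [h3]
    simp
    ring
  · intro v
    have h1 := dependencePoly_union_le F hz h0 (nbrIn F univ v) (univ \ nbrIn F univ v)
      disjoint_sdiff
    have h2 := h (nbrIn F univ v ∪ (univ \ nbrIn F univ v))
    have h3 : ∑ u, (if F.Adj v u then (0 : ℝ) else 1) * dependencePoly F (nbrIn F univ u) z =
        ∑ u ∈ univ \ nbrIn F univ v, dependencePoly F (nbrIn F univ u) z := by
      have : univ \ nbrIn F univ v = univ.filter fun u => ¬ F.Adj v u := by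
        ext u; simp [mem_nbrIn]
      rw [this, sum_filter]
      refine sum_congr rfl fun u _ => ?_
      split_ifs <;> simp
    rw [h3]
    linarith

/-- The first point at which the dependence polynomial of some induced subgraph vanishes. -/
theorem exists_root_dependencePoly [Fintype V] [Nonempty V] (F : SimpleGraph V)
    (he : 0 < (Fintype.card V : ℝ) ^ 2 - 2 * cliqueCount F univ 2) :
    ∃ r : ℝ, 0 < r ∧ (∀ S, 0 ≤ dependencePoly F S r) ∧ dependencePoly F univ r = 0 ∧
      r * ((Fintype.card V : ℝ) ^ 2 - 2 * cliqueCount F univ 2) ≤ Fintype.card V := by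
  set q : ℝ := (Fintype.card V : ℝ) ^ 2 - 2 * cliqueCount F univ 2 with hq
  let Z : Set ℝ := Set.Ici 0 ∩ ⋃ S : Finset V, {z | dependencePoly F S z ≤ 0}
  have hZc : IsClosed Z := isClosed_Ici.inter (isClosed_iUnion_of_finite fun S =>
    isClosed_le (continuous_dependencePoly F S) continuous_const)
  have hZb : BddBelow Z := ⟨0, fun z hz => hz.1⟩
  have hZn : Z.Nonempty := by
    -- Any z > n/q would do: positivity of all the polynomials forces zq ≤ n.
    refine ⟨(Fintype.card V + 1) / q, Set.mem_Ici.2 (by positivity), ?_⟩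
    by_contra hcon
    simp only [Set.mem_iUnion, Set.mem_ofPred_eq, not_exists, not_le] at hcon
    have := mul_le_card_of_dependencePoly_pos F (by positivity) hcon
    rw [← hq, div_mul_cancel₀ _ he.ne'] at this
    linarith
  have hr := hZc.csInf_mem hZn hZb
  set r := sInf Z with hrdef
  obtain ⟨hr0, hrS⟩ := hr
  simp only [Set.mem_iUnion, Set.mem_ofPred_eq] at hrS
  obtain ⟨S, hS⟩ := hrS
  have hrpos : 0 < r := by
    refine lt_of_le_of_ne hr0 fun h => ?_
    rw [← h, dependencePoly_at_zero] at hS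
    linarith
  have hgood : ∀ z ∈ Set.Ico 0 r, ∀ S, 0 < dependencePoly F S z := by
    intro z hz S
    by_contra hcon
    have : z ∈ Z := ⟨hz.1, Set.mem_iUnion.2 ⟨S, not_lt.1 hcon⟩⟩
    exact absurd (csInf_le hZb this) (not_le.2 hz.2)
  have hclos : r ∈ closure (Set.Ico 0 r) := by
    rw [closure_Ico hrpos.ne]
    exact ⟨hr0, le_rfl⟩
  have hnn : ∀ S, 0 ≤ dependencePoly F S r := fun S =>
    closure_minimal (s := Set.Ico 0 r) (t := {z | 0 ≤ dependencePoly F S z})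
      (fun z hz => (hgood z hz S).le)
      (isClosed_le continuous_const (continuous_dependencePoly F S)) hclos
  refine ⟨r, hrpos, hnn, le_antisymm ?_ (hnn univ), ?_⟩
  -- The vanishing on some `S` passes to the whole vertex set by antitonicity.
  · exact (dependencePoly_anti F hr0 hnn (subset_univ S)).trans hS
  · exact closure_minimal (s := Set.Ico 0 r) (t := {z | z * q ≤ Fintype.card V})
      (fun z hz => mul_le_card_of_dependencePoly_pos F hz.1 (hgood z hz))
      (isClosed_le (by fun_prop) continuous_const) hclos

/-- Fisher's lower bound for the number of triangles. -/
theorem exists_cubic_le_cliqueCount_three [Fintype V] [Nonempty V] (F : SimpleGraph V)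
    (he : 2 * cliqueCount F univ 2 < Fintype.card V ^ 2) :
    ∃ y : ℝ, 0 < y ∧
      (Fintype.card V : ℝ) ^ 2 - 2 * cliqueCount F univ 2 ≤ Fintype.card V * y ∧
      y ^ 3 - Fintype.card V * y ^ 2 + cliqueCount F univ 2 * y ≤ cliqueCount F univ 3 := by
  have he' : 0 < (Fintype.card V : ℝ) ^ 2 - 2 * cliqueCount F univ 2 := by
    rw [sub_pos]
    exact_mod_cast he
  obtain ⟨r, hr, hnn, h0, hle⟩ := exists_root_dependencePoly F he'
  refine ⟨r⁻¹, inv_pos.2 hr, ?_, ?_⟩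
  · rw [← div_eq_mul_inv, le_div_iff₀ hr, mul_comm]
    exact hle
  -- Four terms reach the triangles with the favourable sign; multiplying by r⁻³ turns the
  -- inequality into a cubic in y = r⁻¹.
  · have h := dependencePoly_bonferroni F hr.le hnn 4 univ
    rw [h0] at h
    simp only [sum_range_succ, range_zero, sum_empty, cliqueCount_zero, cliqueCount_one,
      card_univ] at h
    have h' := mul_nonneg (pow_pos (inv_pos.2 hr) 3).le h
    have hr' : r * r⁻¹ = 1 := mul_inv_cancel₀ hr.ne'
    generalize r⁻¹ = y at *
    have e1 : y ^ 3 * r = y ^ 2 := by linear_combination y ^ 2 * hr'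
    have e2 : y ^ 3 * r ^ 2 = y := by linear_combination (y ^ 2 * r + y) * hr'
    have e3 : y ^ 3 * r ^ 3 = 1 := by
      linear_combination (y ^ 2 * r ^ 2 + y * r + 1) * hr'
    have e4 : y ^ 3 - Fintype.card V * (y ^ 3 * r) + cliqueCount F univ 2 * (y ^ 3 * r ^ 2) ≤
        cliqueCount F univ 3 * (y ^ 3 * r ^ 3) := by
      push_cast at h'
      linarith
    rwa [e1, e2, e3, mul_one] at e4

theorem two_mul_cliqueCount_two_lt [Fintype V] [Nonempty V] (F : SimpleGraph V) :
    2 * cliqueCount F univ 2 < Fintype.card V ^ 2 := by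
  rw [← sum_card_nbrIn, sq, ← smul_eq_mul (Fintype.card V), ← card_univ, ← sum_const]
  refine sum_lt_sum_of_nonempty univ_nonempty fun v _ => card_lt_card ?_
  rw [ssubset_univ_iff]
  intro h
  exact F.loopless.irrefl v (mem_nbrIn.1 (h ▸ mem_univ v)).2

/-- Among the graphs with the order and size of the complete tripartite graph `K_{a,a,b}`, `b ≤ a`,
that graph has the fewest triangles. -/
theorem cliqueCount_three_ge_tripartite [Fintype V] (F : SimpleGraph V) {a b : ℕ} (hba : b ≤ a)
    (hV : Fintype.card V = 2 * a + b) (he : cliqueCount F univ 2 = a ^ 2 + 2 * a * b) :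
    a ^ 2 * b ≤ cliqueCount F univ 3 := by
  rcases Nat.eq_zero_or_pos a with rfl | ha
  · simp
  have : Nonempty V := Fintype.card_pos_iff.1 (by omega)
  obtain ⟨y, hy, h1, h2⟩ := exists_cubic_le_cliqueCount_three F (two_mul_cliqueCount_two_lt F)
  rw [hV, he] at h1 h2
  push_cast at h1 h2
  have ha' : (0 : ℝ) < a := by exact_mod_cast ha
  have hb' : (0 : ℝ) ≤ b := by positivity
  have hba' : (b : ℝ) ≤ a := by exact_mod_cast hba
  -- Here n² - 2e = 2a² + b² ≥ (2a + b)b, because b ≤ a.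
  have hyb : (b : ℝ) ≤ y := by
    by_contra hcon
    have : (2 * a + b : ℝ) * (b - y) > 0 := mul_pos (by positivity) (by linarith)
    nlinarith
  have h3 : (0 : ℝ) ≤ (y - a) ^ 2 * (y - b) := mul_nonneg (sq_nonneg _) (by linarith)
  have h4 : (a ^ 2 * b : ℝ) ≤ cliqueCount F univ 3 := by nlinarith
  exact_mod_cast h4

end Fisher

/-! ### The Lovász–Simonovits triangle bound. -/

section LovaszSimonovits

open Finset
open scoped Classical

variable {V : Type*} [Fintype V]

theorem exists_add_edge (F : SimpleGraph V) {u w : V} (huw : u ≠ w) (hn : ¬ F.Adj u w) :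
    ∃ F' : SimpleGraph V, cliqueCount F' univ 2 = cliqueCount F univ 2 + 1 ∧
      cliqueCount F' univ 3 = cliqueCount F univ 3 + #(nbrIn F (nbrIn F univ u) w) :=
  ⟨F ⊔ edge u w, cliqueCount_add_edge huw hn fun x y => by
    rw [sup_adj, edge_adj]
    constructor
    · rintro (h | ⟨h, -⟩)
      · exact Or.inl h
      · exact Or.inr (by tauto)
    · rintro (h | ⟨rfl, rfl⟩ | ⟨rfl, rfl⟩)
      · exact Or.inl h
      · exact Or.inr ⟨by tauto, huw⟩
      · exact Or.inr ⟨by tauto, huw.symm⟩⟩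

theorem exists_delete_edge (F : SimpleGraph V) {u w : V} (h : F.Adj u w) :
    ∃ F' : SimpleGraph V, cliqueCount F univ 2 = cliqueCount F' univ 2 + 1 ∧
      cliqueCount F univ 3 = cliqueCount F' univ 3 + #(nbrIn F (nbrIn F univ u) w) := by
  have hadj : ∀ x y, (F.deleteEdges {s(u, w)}).Adj x y ↔
      F.Adj x y ∧ ¬ ((x = u ∧ y = w) ∨ (x = w ∧ y = u)) := by
    intro x y
    rw [deleteEdges_adj, Set.mem_singleton_iff, Sym2.eq_iff]
  have hN : nbrIn (F.deleteEdges {s(u, w)}) (nbrIn (F.deleteEdges {s(u, w)}) univ u) w =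
      nbrIn F (nbrIn F univ u) w := by
    ext x
    simp only [mem_nbrIn, mem_univ, true_and, hadj]
    constructor
    · exact fun h' => ⟨h'.1.1, h'.2.1⟩
    · rintro ⟨h1, h2⟩
      have := h1.ne
      have := h2.ne
      have := h.ne
      refine ⟨⟨h1, ?_⟩, h2, ?_⟩ <;> tauto
  refine ⟨F.deleteEdges {s(u, w)}, ?_⟩
  rw [← hN]
  refine cliqueCount_add_edge h.ne ?_ fun x y => ?_
  · rw [hadj]; tauto
  · rw [hadj]
    constructor
    · tauto
    · rintro (h' | ⟨rfl, rfl⟩ | ⟨rfl, rfl⟩)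
      · exact h'.1
      · exact h
      · exact h.symm

theorem exists_card_mul_degree_le [Nonempty V] (F : SimpleGraph V) :
    ∃ v, Fintype.card V * #(nbrIn F univ v) ≤ 2 * cliqueCount F univ 2 := by
  obtain ⟨v, -, hv⟩ := exists_min_image univ (fun v => #(nbrIn F univ v)) univ_nonempty
  refine ⟨v, ?_⟩
  rw [← sum_card_nbrIn, ← smul_eq_mul, ← card_univ]
  exact card_nsmul_le_sum _ _ _ hv

/-- A vertex that is not adjacent to all others has a nonneighbour. -/
theorem exists_not_adj_of_degree_lt (F : SimpleGraph V) {v : V}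
    (h : #(nbrIn F univ v) + 1 < Fintype.card V) : ∃ w, v ≠ w ∧ ¬ F.Adj v w := by
  by_contra! hcon
  have h1 : univ ⊆ insert v (nbrIn F univ v) := fun w _ => by
    rw [mem_insert, mem_nbrIn]
    by_cases hvw : w = v
    · exact Or.inl hvw
    · exact Or.inr ⟨mem_univ _, hcon w fun h => hvw h.symm⟩
  have h2 := card_le_card h1
  have h3 := card_insert_le v (nbrIn F univ v)
  rw [card_univ] at h2
  omega

theorem codegree_le_degree (F : SimpleGraph V) (v w : V) :
    #(nbrIn F (nbrIn F univ v) w) ≤ #(nbrIn F univ v) :=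
  card_le_card (nbrIn_subset _ _ _)

/-- The top case k = h has the size of K_{h,h,1}. Below it, adding an edge to a counterexample must
create more than `h` triangles, by the case k + 1. Hence the minimum degree is exactly h + 1 and a
minimum-degree neighbourhood is completely joined to its complement. -/
theorem cliqueCount_three_ge_odd {h : ℕ} (hV : Fintype.card V = 2 * h + 1) {k : ℕ} (hk : k ≤ h)
    (F : SimpleGraph V) (he : cliqueCount F univ 2 = h * (h + 1) + k) :
    k * h ≤ cliqueCount F univ 3 := by
  have : Nonempty V := Fintype.card_pos_iff.1 (by omega)
  induction hk using Nat.decreasingInduction generalizing F with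
  | self =>
    have := cliqueCount_three_ge_tripartite F (a := h) (b := 1)
    by_cases hh : 1 ≤ h
    · have := this hh hV (by rw [he]; ring)
      nlinarith
    · simp [show h = 0 by omega]
  | of_succ k hk ih =>
    by_contra! hcon
    have hco : ∀ u w, u ≠ w → ¬ F.Adj u w → h + 1 ≤ #(nbrIn F (nbrIn F univ u) w) := by
      intro u w huw hn
      obtain ⟨F', h1, h2⟩ := exists_add_edge F huw hn
      have h3 := ih F' (by rw [h1, he]; ring)
      rw [h2, add_mul] at h3
      omega
    obtain ⟨v, hv⟩ := exists_card_mul_degree_le F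
    rw [hV, he] at hv
    have hd : #(nbrIn F univ v) ≤ h + 1 := by
      by_contra! hd
      nlinarith [Nat.mul_le_mul_left (2 * h + 1) hd]
    rcases Nat.lt_or_ge (#(nbrIn F univ v)) (h + 1) with hlt | hge
    · obtain ⟨w, hvw, hn⟩ := exists_not_adj_of_degree_lt F (v := v) (by omega)
      have := hco v w hvw hn
      have := codegree_le_degree F v w
      omega
    · have hd' : #(nbrIn F univ v) = h + 1 := le_antisymm hd hge
      have hall : ∀ w u, ¬ F.Adj v w → F.Adj v u → F.Adj w u := by
        intro w u hw hu
        by_cases hvw : v = w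
        · exact hvw ▸ hu
        have heq := eq_of_subset_of_card_le (nbrIn_subset F (nbrIn F univ v) w)
          (hd'.trans_le (hco v w hvw hw))
        exact (mem_nbrIn.1 (heq.symm ▸ mem_nbrIn.2 ⟨mem_univ u, hu⟩ :
          u ∈ nbrIn F (nbrIn F univ v) w)).2
      have := cliqueCount_three_ge_of_nbr F v h 0
        (fun w hw hn => by rw [hd']; exact hco v w hw.symm hn) (by omega) (by omega)
        (fun u w hu hw hwu => absurd (hall w u hw hu) hwu)
      rw [he, hd', hV, show 2 * h + 1 - (h + 1) = h by omega] at this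
      nlinarith

/-- A graph attaining the largest value of a function among the graphs satisfying `P`. -/
theorem exists_max_graph (P : SimpleGraph V → Prop) (f : SimpleGraph V → ℤ) {F : SimpleGraph V}
    (hF : P F) : ∃ F₀, P F₀ ∧ ∀ F', P F' → f F' ≤ f F₀ := by
  obtain ⟨F₀, h1, h2⟩ := exists_max_image (univ.filter P) f ⟨F, mem_filter.2 ⟨mem_univ _, hF⟩⟩
  exact ⟨F₀, (mem_filter.1 h1).2, fun F' hF' => h2 F' (mem_filter.2 ⟨mem_univ _, hF'⟩)⟩

/-- The bound for graphs of order `2h` and size between those of the complete tripartite graphs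
`K_{h,h-1,1}` and `K_{h-1,h-1,2}`. -/
theorem cliqueCount_three_ge_even_high {h : ℕ} (hV : Fintype.card V = 2 * (h + 1)) (hh : 2 ≤ h)
    (F : SimpleGraph V) {k : ℕ} (hk1 : h ≤ k) (hk2 : k + 1 ≤ 2 * h)
    (he : cliqueCount F univ 2 = (h + 1) ^ 2 + k) : (k + 1) * h ≤ cliqueCount F univ 3 := by
  have : Nonempty V := Fintype.card_pos_iff.1 (by omega)
  let P : SimpleGraph V → Prop := fun F =>
    (h + 1) ^ 2 + h ≤ cliqueCount F univ 2 ∧ cliqueCount F univ 2 + 1 ≤ (h + 1) ^ 2 + 2 * h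
  let N : ℤ := (h + 1) ^ 2 + 2 * h
  have hN : 9 ≤ N := by
    have : (2 : ℤ) ≤ h := by exact_mod_cast hh
    nlinarith
  -- `N` exceeds every admissible edge count, so this maximises he - t first and breaks ties by e.
  -- Away from the ends of the size range, nonedges then have codegree above `h` and edges at most
  -- `h`.
  obtain ⟨G, hG, hmax⟩ := exists_max_graph P (fun F =>
    N * (h * cliqueCount F univ 2 - cliqueCount F univ 3) + cliqueCount F univ 2)
    (F := F) ⟨by omega, by omega⟩
  obtain ⟨j, hj⟩ := Nat.exists_eq_add_of_le (show (h + 1) ^ 2 ≤ cliqueCount G univ 2 by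
    have := hG.1; omega)
  have hj1 : h ≤ j := by have := hG.1; omega
  have hj2 : j + 1 ≤ 2 * h := by have := hG.2; omega
  have hmain : (j + 1) * h ≤ cliqueCount G univ 3 := by
    rcases Nat.lt_or_ge (j + 1) (2 * h) with hlt | hge
    · have hco : ∀ u w, u ≠ w → ¬ G.Adj u w → h + 1 ≤ #(nbrIn G (nbrIn G univ u) w) := by
        intro u w huw hn
        obtain ⟨G', h1, h2⟩ := exists_add_edge G huw hn
        have h3 := hmax G' ⟨by omega, by omega⟩
        rw [h1, h2] at h3
        push_cast at h3
        by_contra! hcon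
        have hcon' : (0 : ℤ) ≤ h - #(nbrIn G (nbrIn G univ u) w) := by omega
        nlinarith [mul_nonneg (show 0 ≤ N by omega) hcon']
      obtain ⟨v, hv⟩ := exists_card_mul_degree_le G
      rw [hV, hj] at hv
      have hd : #(nbrIn G univ v) ≤ h + 2 := by
        by_contra! hd
        nlinarith [Nat.mul_le_mul_left (2 * (h + 1)) hd]
      have hd2 : h + 1 ≤ #(nbrIn G univ v) := by
        by_contra! hd2
        obtain ⟨w, hvw, hn⟩ := exists_not_adj_of_degree_lt G (v := v) (by omega)
        have := hco v w hvw hn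
        have := codegree_le_degree G v w
        omega
      rcases Nat.lt_or_ge (#(nbrIn G univ v)) (h + 2) with hlt' | hge'
      · have hd' : #(nbrIn G univ v) = h + 1 := by omega
        have hall : ∀ w u, ¬ G.Adj v w → G.Adj v u → G.Adj w u := by
          intro w u hw hu
          by_cases hvw : v = w
          · exact hvw ▸ hu
          have heq := eq_of_subset_of_card_le (nbrIn_subset G (nbrIn G univ v) w)
            (hd'.trans_le (hco v w hvw hw))
          exact (mem_nbrIn.1 (heq.symm ▸ mem_nbrIn.2 ⟨mem_univ u, hu⟩ :
            u ∈ nbrIn G (nbrIn G univ v) w)).2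
        have := cliqueCount_three_ge_of_nbr G v (h + 1) 0
          (fun w hw hn => by rw [hd']; exact hco v w hw.symm hn) (by omega) (by omega)
          (fun u w hu hw hwu => absurd (hall w u hw hu) hwu)
        rw [hj, hd', hV, show 2 * (h + 1) - (h + 1) = h + 1 by omega] at this
        nlinarith
      · have hd' : #(nbrIn G univ v) = h + 2 := by omega
        -- Deleting an edge therefore stays within the admissible sizes.
        have hjh : h < j := by
          rw [hd'] at hv
          nlinarith
        have hed : ∀ u, G.Adj v u → #(nbrIn G (nbrIn G univ v) u) ≤ h := by
          intro u hu
          obtain ⟨G', h1, h2⟩ := exists_delete_edge G hu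
          have h3 := hmax G' ⟨by omega, by omega⟩
          rw [h1, h2] at h3
          push_cast at h3
          by_contra! hcon
          have hcon' : (0 : ℤ) ≤ #(nbrIn G (nbrIn G univ v) u) - h - 1 := by omega
          nlinarith [mul_nonneg (show 0 ≤ N by omega) hcon']
        have := cliqueCount_three_ge_of_nbr G v h 1
          (fun w hw hn => by rw [hd']; have := hco v w hw.symm hn; omega) (by omega) (by omega)
          (fun u w hu _ _ => hed u hu)
        rw [hj, hd', hV, show 2 * (h + 1) - (h + 2) = h by omega] at this
        nlinarith
    -- The upper end of the range is the size of K_{h,h,2}.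
    · have hj3 : j + 1 = 2 * h := by omega
      have := cliqueCount_three_ge_tripartite G (a := h) (b := 2) hh (by omega)
        (by nlinarith)
      rw [hj3]
      nlinarith
  have h1 := hmax F ⟨by omega, by omega⟩
  rw [he, hj] at h1
  by_contra! hcon
  have hmain' : ((j : ℤ) + 1) * h ≤ cliqueCount G univ 3 := by exact_mod_cast hmain
  have hcon' : (cliqueCount F univ 3 : ℤ) + 1 ≤ ((k : ℤ) + 1) * h := by exact_mod_cast hcon
  push_cast at h1
  have hN0 : 0 ≤ N := by omega
  have e1 := mul_le_mul_of_nonneg_left hmain' hN0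
  have e2 := mul_le_mul_of_nonneg_left hcon' hN0
  have hjk : (j : ℤ) < N := by
    have : (j : ℤ) + 1 ≤ 2 * h := by exact_mod_cast hj2
    have : N = (h + 1) ^ 2 + 2 * h := rfl
    nlinarith
  have hk0 : (0 : ℤ) ≤ k := by positivity
  nlinarith

/-- Below the top case no structure is needed: a vertex of minimum degree has degree at most h + 1,
so an edge added there creates at most h + 1 triangles, exactly the increment of the bound. -/
theorem cliqueCount_three_ge_even {h : ℕ} (hV : Fintype.card V = 2 * (h + 1)) {k : ℕ} (hk : k ≤ h)
    (F : SimpleGraph V) (he : cliqueCount F univ 2 = (h + 1) ^ 2 + k) :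
    k * (h + 1) ≤ cliqueCount F univ 3 := by
  have : Nonempty V := Fintype.card_pos_iff.1 (by omega)
  induction hk using Nat.decreasingInduction generalizing F with
  | self =>
    rcases Nat.lt_or_ge h 2 with hh | hh
    · interval_cases h
      · simp
      -- Four vertices, five edges: y ≥ 3/2 makes Fisher's cubic exceed 1, and integrality gives two
      -- triangles.
      · obtain ⟨y, hy, h1, h2⟩ :=
          exists_cubic_le_cliqueCount_three F (two_mul_cliqueCount_two_lt F)
        rw [hV, he] at h1 h2
        norm_num at h1 h2
        by_contra! hcon
        have : (cliqueCount F univ 3 : ℝ) ≤ 1 := by exact_mod_cast Nat.lt_succ_iff.1 hcon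
        nlinarith [mul_nonneg (show 0 ≤ y - 3 / 2 by linarith) (sq_nonneg (y - 7 / 4)),
          sq_nonneg (y - 7 / 4)]
    · have := cliqueCount_three_ge_even_high hV hh F le_rfl (by omega) he
      linarith
  | of_succ k hk ih =>
    by_contra! hcon
    obtain ⟨v, hv⟩ := exists_card_mul_degree_le F
    rw [hV, he] at hv
    have hd : #(nbrIn F univ v) ≤ h + 1 := by
      by_contra! hd
      nlinarith [Nat.mul_le_mul_left (2 * (h + 1)) hd]
    obtain ⟨w, hvw, hn⟩ := exists_not_adj_of_degree_lt F (v := v) (by omega)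
    obtain ⟨F', h1, h2⟩ := exists_add_edge F hvw hn
    have h3 := ih F' (by rw [h1, he]; ring)
    rw [h2, add_mul] at h3
    have := codegree_le_degree F v w
    omega

/-- The theorem of Lovász and Simonovits on the number of triangles in graphs with
`⌊n ^ 2 / 4⌋ + k` edges. -/
theorem cliqueCount_three_ge {n k : ℕ} (hV : Fintype.card V = n) (hk : 2 * k < n)
    (F : SimpleGraph V) (he : cliqueCount F univ 2 = (n + 1) / 2 * (n / 2) + k) :
    k * (n / 2) ≤ cliqueCount F univ 3 := by
  obtain ⟨h, rfl | rfl⟩ := Nat.even_or_odd' n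
  · obtain ⟨h, rfl⟩ := Nat.exists_eq_succ_of_ne_zero (show h ≠ 0 by omega)
    rw [show (2 * h.succ + 1) / 2 = h + 1 by omega, show 2 * h.succ / 2 = h + 1 by omega] at *
    exact cliqueCount_three_ge_even hV (by omega) F (by rw [he]; ring)
  · rw [show (2 * h + 1 + 1) / 2 = h + 1 by omega, show (2 * h + 1) / 2 = h by omega] at *
    exact cliqueCount_three_ge_odd hV (by omega) F (by rw [he]; ring)

end LovaszSimonovits

/-! ### Independence polynomials and reduction to triangles of the complement. -/

section IndependencePolynomial

open Finset
open scoped Classical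

theorem indepCount_eq_cliqueCount {V : Type} [Fintype V] (G : SimpleGraph V) (j : ℕ) :
    indepCount G j = cliqueCount Gᶜ univ j := by
  rw [indepCount, cliqueCount, ← Set.ncard_coe_finset]
  congr 1
  ext s
  simp [mem_cliquesIn, isNIndepSet_iff]

theorem indepCount_eq_zero_of_card_lt {V : Type} [Fintype V] (G : SimpleGraph V) {j : ℕ}
    (h : Fintype.card V < j) : indepCount G j = 0 := by
  rw [indepCount]
  convert Set.ncard_empty (Finset V)
  refine Set.eq_empty_of_forall_notMem fun s hs => ?_
  have := card_le_univ s
  have := (show G.IsNIndepSet j s from hs).card_eq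
  omega

theorem indepPoly_coeff {V : Type} [Fintype V] (G : SimpleGraph V) (j : ℕ) :
    (indepPoly G).coeff j = indepCount G j := by
  rw [indepPoly, finsetSum_coeff]
  simp only [coeff_C_mul_X_pow]
  rw [sum_ite_eq]
  split_ifs with h
  · rfl
  · rw [indepCount_eq_zero_of_card_lt G (by simpa using h), Nat.cast_zero]

theorem indepPoly_eq_sum_indep {V : Type} [Fintype V] (G : SimpleGraph V) :
    indepPoly G = ∑ s : Finset V, if G.IsIndepSet (s : Set V) then (X : ℝ[X]) ^ #s else 0 := by
  ext j
  rw [indepPoly_coeff, ← sum_filter, finsetSum_coeff]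
  simp only [coeff_X_pow]
  rw [← natCast_card_filter, indepCount, ← Set.ncard_coe_finset]
  congr 2
  ext s
  simp [isNIndepSet_iff, eq_comm]

theorem isIndepSet_sum_iff {α β : Type} (G : SimpleGraph α) (H : SimpleGraph β)
    (s : Finset α) (t : Finset β) :
    (G ⊕g H).IsIndepSet (s.disjSum t : Set (α ⊕ β)) ↔
      G.IsIndepSet (s : Set α) ∧ H.IsIndepSet (t : Set β) := by
  constructor
  · intro h
    refine ⟨fun x hx y hy hxy => ?_, fun x hx y hy hxy => ?_⟩
    · have := h (x := .inl x) (by simpa using hx) (y := .inl y) (by simpa using hy) (by simpa)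
      simpa using this
    · have := h (x := .inr x) (by simpa using hx) (y := .inr y) (by simpa using hy) (by simpa)
      simpa using this
  · rintro ⟨h1, h2⟩ (x | x) hx (y | y) hy hxy
    · simpa using h1 (x := x) (by simpa using hx) (y := y) (by simpa using hy) (by simpa using hxy)
    · simp
    · simp
    · simpa using h2 (x := x) (by simpa using hx) (y := y) (by simpa using hy) (by simpa using hxy)

theorem indepPoly_sum {α β : Type} [Fintype α] [Fintype β] (G : SimpleGraph α)
    (H : SimpleGraph β) : indepPoly (G ⊕g H) = indepPoly G * indepPoly H := by
  simp only [indepPoly_eq_sum_indep]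
  rw [sum_mul_sum, ← sum_product', univ_product_univ]
  refine Fintype.sum_equiv sumEquiv.toEquiv _ _ fun s => ?_
  obtain ⟨⟨s₁, s₂⟩, rfl⟩ := sumEquiv.symm.surjective s
  have : sumEquiv.toEquiv (sumEquiv.symm (s₁, s₂)) = (s₁, s₂) :=
    sumEquiv.apply_symm_apply (s₁, s₂)
  rw [this, sumEquiv_symm_apply]
  simp only [isIndepSet_sum_iff, card_disjSum, ite_and, pow_add]
  split_ifs <;> simp

theorem indepCount_zero {V : Type} [Fintype V] (G : SimpleGraph V) : indepCount G 0 = 1 := by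
  rw [indepCount_eq_cliqueCount, cliqueCount_zero]

theorem indepCount_one {V : Type} [Fintype V] (G : SimpleGraph V) :
    indepCount G 1 = Fintype.card V := by
  rw [indepCount_eq_cliqueCount, cliqueCount_one, card_univ]

theorem cliqueCount_two_eq_ncard {V : Type*} [Fintype V] (F : SimpleGraph V) :
    cliqueCount F univ 2 = F.edgeSet.ncard := by
  have h1 := sum_card_nbrIn F univ
  have h2 := F.sum_degrees_eq_twice_card_edges
  have h3 : ∀ v, #(nbrIn F univ v) = F.degree v := fun v => by
    rw [← card_neighborFinset_eq_degree]
    congr 1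
    ext u
    simp [mem_nbrIn]
  rw [sum_congr rfl fun v _ => h3 v, h2] at h1
  rw [← F.coe_edgeFinset, Set.ncard_coe_finset]
  omega

theorem indepCount_two_add {V : Type} [Fintype V] (G : SimpleGraph V) :
    indepCount G 2 + G.edgeSet.ncard = (Fintype.card V).choose 2 := by
  rw [indepCount_eq_cliqueCount, cliqueCount_two_eq_ncard, ← Gᶜ.coe_edgeFinset,
    ← G.coe_edgeFinset, Set.ncard_coe_finset, Set.ncard_coe_finset]
  have h1 := Gᶜ.sum_degrees_eq_twice_card_edges
  have h2 := G.sum_degrees_eq_twice_card_edges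
  have h3 : ∑ v, (Gᶜ.degree v + G.degree v) = ∑ _v : V, (Fintype.card V - 1) :=
    sum_congr rfl fun v _ => by
      have := G.degree_compl v
      have := G.degree_lt_card_verts v
      omega
  rw [sum_add_distrib, h1, h2, sum_const, card_univ, smul_eq_mul] at h3
  have h4 := Nat.triangle_succ (Fintype.card V - 1)
  rw [Nat.choose_two_right]
  omega

theorem indepCount_eq_zero_of_free {V : Type} (G : SimpleGraph V) {i j : ℕ}
    (h : G.IndepSetFree i) (hij : i ≤ j) : indepCount G j = 0 := by
  rw [indepCount]
  convert Set.ncard_empty (Finset V)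
  exact Set.eq_empty_of_forall_notMem fun s hs =>
    ((cliqueFree_compl G).2 h).mono hij s ((isNClique_compl G).2 hs)

theorem indepPoly_of_indepSetFree_three {V : Type} [Fintype V] (G : SimpleGraph V)
    (h : G.IndepSetFree 3) :
    indepPoly G = 1 + C (Fintype.card V : ℝ) * X + C (indepCount G 2 : ℝ) * X ^ 2 := by
  ext j
  rw [indepPoly_coeff]
  match j with
  | 0 => simp [indepCount_zero]
  | 1 => simp [indepCount_one, coeff_one]
  | 2 => simp [coeff_one]
  | j + 3 =>
    rw [indepCount_eq_zero_of_free G h (by omega)]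
    simp [coeff_one]

theorem indepPoly_completeGraph (q : ℕ) :
    indepPoly (completeGraph (Fin q)) = 1 + C (q : ℝ) * X := by
  have h2 : (completeGraph (Fin q)).IndepSetFree 2 := by
    intro t ht
    obtain ⟨x, y, hxy, rfl⟩ := card_eq_two.1 ht.card_eq
    exact ht.isIndepSet (x := x) (by simp) (y := y) (by simp) hxy hxy
  have h3 : (completeGraph (Fin q)).IndepSetFree 3 :=
    (cliqueFree_compl _).1 (((cliqueFree_compl _).2 h2).mono (by norm_num))
  rw [indepPoly_of_indepSetFree_three _ h3, indepCount_eq_zero_of_free _ h2 le_rfl]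
  simp

theorem indepCount_two_goodDeletion {p k : ℕ} {D : Finset (Sym2 (Fin p))}
    (hD : IsGoodDeletion p k D) :
    indepCount ((completeGraph (Fin p)).deleteEdges (D : Set (Sym2 (Fin p)))) 2 = k := by
  have h1 := indepCount_two_add
    ((completeGraph (Fin p)).deleteEdges (D : Set (Sym2 (Fin p))))
  have h2 := indepCount_two_add (completeGraph (Fin p))
  have h3 : indepCount (completeGraph (Fin p)) 2 = 0 := by
    have := indepPoly_coeff (completeGraph (Fin p)) 2
    rw [indepPoly_completeGraph] at this
    have h : (0 : ℝ) = indepCount (completeGraph (Fin p)) 2 := by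
      simpa [coeff_one] using this
    exact_mod_cast h.symm
  rw [edgeSet_deleteEdges] at h1
  have h4 := Set.ncard_sdiff_add_ncard_of_subset hD.1
  rw [Set.ncard_coe_finset, hD.2.1] at h4
  omega

theorem indepPoly_deletedTwoCliques {p q k : ℕ} {D : Finset (Sym2 (Fin p))}
    (hD : IsGoodDeletion p k D) :
    indepPoly (deletedTwoCliques p q D) =
      1 + C ((p + q : ℕ) : ℝ) * X + C ((p * q + k : ℕ) : ℝ) * X ^ 2 +
        C ((k * q : ℕ) : ℝ) * X ^ 3 := by
  rw [deletedTwoCliques, indepPoly_sum, indepPoly_completeGraph,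
    indepPoly_of_indepSetFree_three _ hD.2.2, indepCount_two_goodDeletion hD, Fintype.card_fin]
  push_cast
  simp only [map_add, map_mul]
  ring

theorem indepPoly_threeCliques (a b : ℕ) :
    indepPoly (threeCliques a b) =
      1 + C ((2 * a + b : ℕ) : ℝ) * X + C ((a ^ 2 + 2 * a * b : ℕ) : ℝ) * X ^ 2 +
        C ((a ^ 2 * b : ℕ) : ℝ) * X ^ 3 := by
  rw [threeCliques, indepPoly_sum, indepPoly_sum, indepPoly_completeGraph,
    indepPoly_completeGraph]
  push_cast
  simp only [map_add, map_mul, map_pow, map_ofNat]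
  ring

/-- The size of a graph, read off its independence polynomial. -/
theorem hasOrderSize_of_indepPoly {V : Type} [Fintype V] (G : SimpleGraph V) {n m e t : ℕ}
    (hV : Fintype.card V = n) (he : e + m = n.choose 2)
    (h : indepPoly G = 1 + C (n : ℝ) * X + C (e : ℝ) * X ^ 2 + C (t : ℝ) * X ^ 3) :
    HasOrderSize n m G := by
  have h1 := indepPoly_coeff G 2
  rw [h] at h1
  have h2 : e = indepCount G 2 := by
    simpa [coeff_one, coeff_X, coeff_X_pow] using h1
  have h3 := indepCount_two_add G
  rw [hV] at h3
  exact ⟨hV, by omega⟩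

/-- A graph whose independence polynomial is cubic is optimally-least as soon as every graph whose
complement has the same order and size has at least as many triangles in its complement. -/
theorem isOptimallyLeast_of_cliqueCount {V : Type} [Fintype V] (H : SimpleGraph V) {n m e t : ℕ}
    (hH : HasOrderSize n m H) (he : e + m = n.choose 2)
    (h : indepPoly H = 1 + C (n : ℝ) * X + C (e : ℝ) * X ^ 2 + C (t : ℝ) * X ^ 3)
    (ht : ∀ (W : Type) [Fintype W] (F : SimpleGraph W), Fintype.card W = n →
      cliqueCount F univ 2 = e → t ≤ cliqueCount F univ 3) :
    IsOptimallyLeast n m H := by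
  refine ⟨hH, fun W _ G hG x hx => ?_⟩
  have h2 := indepCount_two_add G
  rw [hG.1, hG.2] at h2
  have h2' : indepCount G 2 = e := by omega
  have h3 : t ≤ indepCount G 3 := by
    rw [indepCount_eq_cliqueCount]
    exact ht W Gᶜ hG.1 (by rw [← indepCount_eq_cliqueCount, h2'])
  have hterm : ∀ j, 0 ≤ (indepCount G j : ℝ) * x ^ j := fun j => by positivity
  -- The range runs to n + 4 so that it contains degrees 0 to 3 even for small `n`.
  have hsum : (indepPoly G).eval x = ∑ j ∈ range (n + 4), (indepCount G j : ℝ) * x ^ j := by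
    rw [indepPoly, eval_finsetSum]
    simp only [eval_mul, eval_C, eval_pow, eval_X]
    refine sum_subset (range_subset_range.2 (by rw [hG.1]; omega)) fun j _ hj => ?_
    rw [indepCount_eq_zero_of_card_lt G (by simpa using hj)]
    simp
  have hge : ∑ j ∈ range 4, (indepCount G j : ℝ) * x ^ j ≤ (indepPoly G).eval x := by
    rw [hsum]
    exact sum_le_sum_of_subset_of_nonneg (range_subset_range.2 (by omega)) fun j _ _ => hterm j
  refine le_trans ?_ hge
  simp only [sum_range_succ, range_zero, sum_empty, indepCount_zero, indepCount_one, h2', hG.1]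
  rw [h]
  simp only [eval_add, eval_mul, eval_one, eval_C, eval_pow, eval_X]
  have h3' : (t : ℝ) ≤ indepCount G 3 := by exact_mod_cast h3
  have := mul_le_mul_of_nonneg_right h3' (pow_nonneg hx 3)
  push_cast
  linarith

/-- Deleting the edges of a star creates no independent set of size `3`. -/
theorem exists_isGoodDeletion {p k : ℕ} (hk : k < p) :
    ∃ D : Finset (Sym2 (Fin p)), IsGoodDeletion p k D := by
  let o : Fin p := ⟨0, by omega⟩
  let f : Fin k → Sym2 (Fin p) := fun i => s(o, ⟨i + 1, by omega⟩)
  have hf : Function.Injective f := by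
    intro i j hij
    have := Sym2.congr_right.1 hij
    simpa [Fin.ext_iff] using this
  refine ⟨univ.image f, ?_, ?_, ?_⟩
  · intro x hx
    simp only [coe_image, coe_univ, Set.image_univ, Set.mem_range] at hx
    obtain ⟨i, rfl⟩ := hx
    change o ≠ _
    simp [o, Fin.ext_iff]
  · rw [card_image_of_injective _ hf, card_univ, Fintype.card_fin]
  · intro t ht
    obtain ⟨x, y, z, hxy, hxz, hyz, rfl⟩ := card_eq_three.1 ht.card_eq
    -- Independent pairs are deleted edges and so contain the centre `o`; three distinct vertices
    -- cannot all pair up this way.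
    have key : ∀ a ∈ ({x, y, z} : Finset (Fin p)), ∀ b ∈ ({x, y, z} : Finset (Fin p)),
        a ≠ b → a = o ∨ b = o := by
      intro a ha b hb hab
      have h1 : ¬ ((completeGraph (Fin p)).deleteEdges _).Adj a b := ht.isIndepSet ha hb hab
      rw [deleteEdges_adj] at h1
      have h2 : s(a, b) ∈ ((univ.image f : Finset _) : Set (Sym2 (Fin p))) := by
        by_contra h2
        exact h1 ⟨hab, h2⟩
      simp only [coe_image, coe_univ, Set.image_univ, Set.mem_range] at h2
      obtain ⟨i, hi⟩ := h2
      rcases Sym2.eq_iff.1 hi with h | h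
      · exact Or.inl h.1.symm
      · exact Or.inr h.1.symm
    have h1 := key x (by simp) y (by simp) hxy
    have h2 := key x (by simp) z (by simp) hxz
    have h3 := key y (by simp) z (by simp) hyz
    grind

end IndependencePolynomial

/-! ### Assembly of the two families. -/

/-- Here `(n + 1) / 2 = ⌈n/2⌉` and `n / 2 = ⌊n/2⌋`. -/
theorem mainTheorem5 :
    (∀ n k m : ℕ, 2 ≤ n → 1 ≤ k → k ≤ n / 2 →
      (m : ℤ) = (n.choose 2 : ℤ) - (((n + 1) / 2 : ℕ) : ℤ) * ((n / 2 : ℕ) : ℤ) - (k : ℤ) →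
      (∀ D : Finset (Sym2 (Fin ((n + 1) / 2))), IsGoodDeletion ((n + 1) / 2) k D →
        HasOrderSize n m (deletedTwoCliques ((n + 1) / 2) (n / 2) D) ∧
        indepPoly (deletedTwoCliques ((n + 1) / 2) (n / 2) D) =
          1 + C (n : ℝ) * X + C ((n.choose 2 : ℝ) - (m : ℝ)) * X ^ 2 +
            C ((k : ℝ) * ((n / 2 : ℕ) : ℝ)) * X ^ 3) ∧
      ((k : ℝ) < (n : ℝ) / 2 →
        (∃ D : Finset (Sym2 (Fin ((n + 1) / 2))), IsGoodDeletion ((n + 1) / 2) k D) ∧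
        ∀ D : Finset (Sym2 (Fin ((n + 1) / 2))), IsGoodDeletion ((n + 1) / 2) k D →
          IsOptimallyLeast n m (deletedTwoCliques ((n + 1) / 2) (n / 2) D))) ∧
    (∀ a b n m : ℕ, 1 ≤ b → b ≤ a → n = 2 * a + b → m = a * (a - 1) + b * (b - 1) / 2 →
      IsOptimallyLeast n m (threeCliques a b) ∧
      indepPoly (threeCliques a b) =
        1 + C (n : ℝ) * X + C ((n.choose 2 : ℝ) - (m : ℝ)) * X ^ 2 +
          C ((a : ℝ) ^ 2 * (b : ℝ)) * X ^ 3) := by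
  
  refine ⟨fun n k m hn _ hk hm => ?_, fun a b n m hb hba hn hm => ?_⟩
  · have hm' : (n + 1) / 2 * (n / 2) + k + m = n.choose 2 := by
      zify
      push_cast at hm
      linarith
    have hV : Fintype.card (Fin ((n + 1) / 2) ⊕ Fin (n / 2)) = n := by
      rw [Fintype.card_sum, Fintype.card_fin, Fintype.card_fin]
      omega
    have hpoly : ∀ D : Finset (Sym2 (Fin ((n + 1) / 2))), IsGoodDeletion ((n + 1) / 2) k D →
        indepPoly (deletedTwoCliques ((n + 1) / 2) (n / 2) D) =
          1 + C (n : ℝ) * X + C (((n + 1) / 2 * (n / 2) + k : ℕ) : ℝ) * X ^ 2 +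
            C ((k * (n / 2) : ℕ) : ℝ) * X ^ 3 := fun D hD => by
      rw [indepPoly_deletedTwoCliques hD, show (n + 1) / 2 + n / 2 = n by omega]
    have hsize := fun D hD => hasOrderSize_of_indepPoly _ hV hm' (hpoly D hD)
    refine ⟨fun D hD => ⟨hsize D hD, ?_⟩, fun hkn => ⟨?_, fun D hD => ?_⟩⟩
    · rw [hpoly D hD, ← hm', Nat.cast_mul, Nat.cast_add _ m, add_sub_cancel_right]
    · refine exists_isGoodDeletion ?_
      rw [lt_div_iff₀ two_pos] at hkn
      have : k * 2 < n := by exact_mod_cast hkn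
      omega
    · rw [lt_div_iff₀ two_pos] at hkn
      have hkn' : k * 2 < n := by exact_mod_cast hkn
      exact isOptimallyLeast_of_cliqueCount _ (hsize D hD) hm' (hpoly D hD)
        fun W _ F hW he => cliqueCount_three_ge hW (by omega) F he
  · have hm' : a ^ 2 + 2 * a * b + m = n.choose 2 := by
      -- Binomial coefficients absorb the truncated subtractions and the division before casting to
      -- the reals.
      have h1 : a * (a - 1) = 2 * a.choose 2 := by
        rw [Nat.choose_two_right, Nat.mul_div_cancel' (Nat.even_mul_pred_self a).two_dvd]
      rw [hm, hn, h1, ← Nat.choose_two_right]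
      rify
      rw [Nat.cast_choose_two, Nat.cast_choose_two, Nat.cast_choose_two]
      push_cast
      ring
    have hV : Fintype.card ((Fin a ⊕ Fin a) ⊕ Fin b) = n := by
      rw [Fintype.card_sum, Fintype.card_sum, Fintype.card_fin, Fintype.card_fin]
      omega
    have hpoly := indepPoly_threeCliques a b
    rw [← hn] at hpoly
    refine ⟨isOptimallyLeast_of_cliqueCount _ (hasOrderSize_of_indepPoly _ hV hm' hpoly) hm' hpoly
      fun W _ F hW he => cliqueCount_three_ge_tripartite F hba (by rw [hW, hn]) he, ?_⟩
    rw [hpoly, ← hm', Nat.cast_add _ m, add_sub_cancel_right, Nat.cast_mul, Nat.cast_pow]
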